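/- Let $X$ be a finite set. A (symmetric) association scheme with $n$ classes on $X$ is a partition $\{R_0,\dots,R_n\}$ of $X\times X$ into non-empty subsets such that the matrices $A_i\in\mathbb{R}^{X\times X}$, with $(A_i)_{xy}=1$ if $(x,y)\in R_i$ and $(A_i)_{xy}=0$ otherwise, satisfy: (i) $A_0=I$; (ii) $\sum_{i=0}^n A_i=J$, the all-ones matrix; (iii) $A_i^T=A_i$ for all $i$; (iv) for all $i,j$ there are nonnegative integers $p_{ij}^k$ with $A_iA_j=\sum_{k=0}^n p_{ij}^kA_k$. A colour class in the scheme is a graph on $X$ with adjacency matrix $A_i$ for some $1\le i\le n$. The edge-connectivity $\lambda(G)$ of a finite graph $G$ with at least two vertices is the largest $k$ such that deleting fewer than $k$ edges never disconnects $G$. **Theorem (Godsil's conjecture).** Let $G$ be a connected graph which is a colour class in an association scheme. Then $G$ is regular, and its edge-connectivity $\lambda(G)$ equals its degree. -/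

import Mathlib

/-- The real `(0, 1)`-matrix of a relation `R ⊆ X × X`: its `(x, y)` entry is `1` if
`(x, y) ∈ R` and `0` otherwise. -/
noncomputable def relMatrix {X : Type*} (R : Set (X × X)) : Matrix X X ℝ :=
  Matrix.of fun x y => R.indicator (fun _ => (1 : ℝ)) (x, y)

theorem relMatrix_eq_one_iff {X : Type*} (R : Set (X × X)) (x y : X) :
    relMatrix R x y = 1 ↔ (x, y) ∈ R := by
  by_cases h : (x, y) ∈ R <;> simp [relMatrix, h]

/-- A (symmetric) association scheme with `n` classes on the finite set `X`: a partition
`R 0, …, R n` of `X × X` into nonempty subsets whose `(0, 1)`-matrices `A 0, …, A n` satisfy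
`A 0 = I`, `∑ A i = J`, `(A i)ᵀ = A i` and `A i * A j = ∑ k, p i j k • A k` with nonnegative
integers `p i j k` (the intersection numbers). -/
structure AssociationScheme (X : Type*) [Fintype X] [DecidableEq X] (n : ℕ) where
  R : Fin (n + 1) → Set (X × X)
  nonempty : ∀ i, (R i).Nonempty
  disjoint : ∀ i j, i ≠ j → Disjoint (R i) (R j)
  iUnion_eq : ⋃ i, R i = Set.univ
  matrix_zero : relMatrix (R 0) = 1
  sum_matrix : ∑ i, relMatrix (R i) = Matrix.of fun _ _ => (1 : ℝ)
  transpose_matrix : ∀ i, (relMatrix (R i)).transpose = relMatrix (R i)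
  mul_matrix : ∀ i j, ∃ p : Fin (n + 1) → ℕ,
    relMatrix (R i) * relMatrix (R j) = ∑ k, (p k : ℝ) • relMatrix (R k)

/-- The graph `G i` (for `i ≠ 0`) on `X` whose adjacency matrix is `A i`:
distinct `x`, `y` are adjacent exactly when `(x, y) ∈ R i`. -/
def AssociationScheme.graph {X : Type*} [Fintype X] [DecidableEq X] {n : ℕ}
    (S : AssociationScheme X n) (i : Fin (n + 1)) (hi : i ≠ 0) : SimpleGraph X where
  Adj x y := (x, y) ∈ S.R i
  symm := ⟨fun x y h => by
    rw [← relMatrix_eq_one_iff] at h ⊢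
    rw [← S.transpose_matrix i, Matrix.transpose_apply]
    exact h⟩
  loopless := ⟨fun x h => by
    have h0 : (x, x) ∈ S.R 0 := by
      rw [← relMatrix_eq_one_iff, S.matrix_zero, Matrix.one_apply_eq]
    exact Set.disjoint_left.mp (S.disjoint i 0 hi) h h0⟩

/-- `G` is a colour class in some association scheme on its vertex set. -/
def SimpleGraph.IsColourClass {X : Type*} [Fintype X] [DecidableEq X] (G : SimpleGraph X) : Prop :=
  ∃ (n : ℕ) (S : AssociationScheme X n) (i : Fin (n + 1)) (hi : i ≠ 0), G = S.graph i hi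

/-- The edge-connectivity of a finite graph: the largest `k` such that `G` is `k`-edge-connected
(that is, deleting fewer than `k` edges never disconnects `G`). For a one-vertex graph, where no
largest `k` exists, the value is `0`. -/
noncomputable def SimpleGraph.edgeConnectivity {V : Type*} (G : SimpleGraph V) : ℕ :=
  sSup {k : ℕ | G.IsEdgeConnected k}

/-- On a finite graph with at least two vertices the maximum in the definition of the
edge-connectivity is attained. -/
theorem SimpleGraph.isGreatest_edgeConnectivity {V : Type*} [Finite V] [Nontrivial V]
    (G : SimpleGraph V) : IsGreatest {k : ℕ | G.IsEdgeConnected k} G.edgeConnectivity := by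
  classical
  have := Fintype.ofFinite V
  obtain ⟨u⟩ : Nonempty V := inferInstance
  have hb : BddAbove {k : ℕ | G.IsEdgeConnected k} :=
    ⟨G.degree u, fun k hk => SimpleGraph.IsEdgeConnected.le_degree hk⟩
  exact ⟨Nat.sSup_mem ⟨0, SimpleGraph.IsEdgeConnected.zero⟩ hb, fun k hk => le_csSup hb hk⟩

/-!
Let `G` be a connected colour class of a symmetric association scheme on `X`, let `L` be its
Laplacian and `J` the all-ones matrix. The relation `R 0` is the diagonal, so a matrix of the
Bose–Mesner algebra has constant diagonal; for the square of the adjacency matrix this says that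
`G` is regular, of degree `k` say.

*Effective resistances.* The algebra is finite-dimensional and contains the invertible matrix
`L + J`, hence also its inverse, the Green's function of `G`. This inverse is constant on the
diagonal and on the edges of `G`. So all edges have the same effective resistance
`2 (|X| - 1) / (|X| k) < 2 / k`, and Dirichlet's principle turns this into the bound
`k (φ x - φ y) ^ 2 < 2 φᵀ L φ` for every edge `xy` and every `φ : X → ℝ` with `φ x ≠ φ y`
(`SimpleGraph.ResistanceBound`, `AssociationScheme.resistanceBound_graph`). The rest of
the argument uses only this bound, regularity and connectedness.

*Cuts.* Let `S` be a side of a minimum cut and suppose that its size `c` is less than `k`. For a cut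
edge `xy` with `x ∈ S`, let `a` be the number of cut edges at `x` and `b` the number at `y`. Moving
one vertex across the cut does not decrease its size, so `2a ≤ k` and `2b ≤ k`. With
`v = k - a - b`, the potential `2 · 1_S + v (δ_x - δ_y)` gives `v ^ 2 < 2c - k`
(`ResistanceBound.sq_add_lt`). If `xy` is chosen with `a + b` minimal, every cut edge from `x` ends
in a vertex with at least `b` cut edges, so `c ≥ a b`. As `a, b ≤ k / 2`, it follows that
`k (k - 2v) ≤ 4 a b ≤ 4c < 4k`, so `k < 2v + 4`; together with `v ^ 2 < 2c - k < k` this bounds `k`,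
and as a cut is even when `k` is even, the only remaining parameters are `k = 5`, `a = b = 2` and
`k = 7`, `{a, b} = {2, 3}`, with `c = a b` (`cut_arith`). In these cases the cut is a complete
bipartite graph (`exists_biclique`), which a further test potential rules out
(`ResistanceBound.false_of_biclique`). So every cut has at least `k` edges.
-/

section

open Finset Matrix

/-! ### The Bose–Mesner algebra -/

namespace AssociationScheme

variable {X : Type*} [Fintype X] [DecidableEq X] {n : ℕ}

/-- The Bose–Mesner algebra of the scheme, as a subspace of the matrix algebra. -/
noncomputable def boseMesner (S : AssociationScheme X n) : Submodule ℝ (Matrix X X ℝ) :=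
  Submodule.span ℝ (Set.range fun i => relMatrix (S.R i))

theorem relMatrix_mem_boseMesner (S : AssociationScheme X n) (i : Fin (n + 1)) :
    relMatrix (S.R i) ∈ S.boseMesner :=
  Submodule.subset_span ⟨i, rfl⟩

theorem one_mem_boseMesner (S : AssociationScheme X n) : (1 : Matrix X X ℝ) ∈ S.boseMesner :=
  S.matrix_zero ▸ S.relMatrix_mem_boseMesner 0

theorem allOnes_mem_boseMesner (S : AssociationScheme X n) :
    (Matrix.of fun _ _ => (1 : ℝ)) ∈ S.boseMesner :=
  S.sum_matrix ▸ Submodule.sum_mem _ fun i _ => S.relMatrix_mem_boseMesner i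

theorem mul_mem_boseMesner (S : AssociationScheme X n) {M N : Matrix X X ℝ}
    (hM : M ∈ S.boseMesner) (hN : N ∈ S.boseMesner) : M * N ∈ S.boseMesner := by
  have h : S.boseMesner * S.boseMesner ≤ S.boseMesner := by
    rw [boseMesner, Submodule.span_mul_span, Submodule.span_le]
    rintro _ ⟨_, ⟨i, rfl⟩, _, ⟨j, rfl⟩, rfl⟩
    obtain ⟨p, hp⟩ := S.mul_matrix i j
    simp only [hp]
    exact Submodule.sum_mem _ fun k _ =>
      Submodule.smul_mem _ _ (S.relMatrix_mem_boseMesner k)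
  exact h (Submodule.mul_mem_mul hM hN)

/-- A matrix of the Bose–Mesner algebra is constant on each relation of the scheme. -/
theorem apply_eq_of_mem_boseMesner (S : AssociationScheme X n) {M : Matrix X X ℝ}
    (hM : M ∈ S.boseMesner) {j : Fin (n + 1)} {x y x' y' : X} (h : (x, y) ∈ S.R j)
    (h' : (x', y') ∈ S.R j) : M x y = M x' y' := by
  induction hM using Submodule.span_induction with
  | mem M hM =>
    obtain ⟨i, rfl⟩ := hM
    change relMatrix (S.R i) x y = relMatrix (S.R i) x' y'
    by_cases hij : i = j
    · subst hij
      rw [(relMatrix_eq_one_iff _ _ _).2 h, (relMatrix_eq_one_iff _ _ _).2 h']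
    · have hd := Set.disjoint_right.1 (S.disjoint i j hij)
      simp [relMatrix, hd h, hd h']
  | zero => rfl
  | add M N _ _ hM hN => simp [hM, hN]
  | smul a M _ hM => simp [hM]

theorem diag_mem (S : AssociationScheme X n) (x : X) : (x, x) ∈ S.R 0 := by
  rw [← relMatrix_eq_one_iff, S.matrix_zero, one_apply_eq]

theorem adjMatrix_graph (S : AssociationScheme X n) (i : Fin (n + 1)) (hi : i ≠ 0)
    [DecidableRel (S.graph i hi).Adj] : (S.graph i hi).adjMatrix ℝ = relMatrix (S.R i) := by
  ext x y
  have hadj : (S.graph i hi).Adj x y ↔ (x, y) ∈ S.R i := Iff.rfl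
  by_cases h : (x, y) ∈ S.R i <;> simp [relMatrix, SimpleGraph.adjMatrix_apply, hadj, h]

theorem isRegularOfDegree_graph (S : AssociationScheme X n) (i : Fin (n + 1)) (hi : i ≠ 0)
    [DecidableRel (S.graph i hi).Adj] (x : X) :
    (S.graph i hi).IsRegularOfDegree ((S.graph i hi).degree x) := by
  intro y
  have h := S.apply_eq_of_mem_boseMesner (S.mul_mem_boseMesner (S.relMatrix_mem_boseMesner i)
    (S.relMatrix_mem_boseMesner i)) (S.diag_mem y) (S.diag_mem x)
  rw [← S.adjMatrix_graph i hi, SimpleGraph.adjMatrix_mul_self_apply_self,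
    SimpleGraph.adjMatrix_mul_self_apply_self] at h
  exact_mod_cast h

theorem lapMatrix_graph_mem_boseMesner (S : AssociationScheme X n) (i : Fin (n + 1)) (hi : i ≠ 0)
    [DecidableRel (S.graph i hi).Adj] : (S.graph i hi).lapMatrix ℝ ∈ S.boseMesner := by
  rcases isEmpty_or_nonempty X with _ | ⟨⟨x⟩⟩
  · rw [Subsingleton.elim ((S.graph i hi).lapMatrix ℝ) 0]
    exact Submodule.zero_mem _
  · have h : (S.graph i hi).degMatrix ℝ = ((S.graph i hi).degree x : ℝ) • 1 := by
      rw [SimpleGraph.degMatrix, smul_one_eq_diagonal]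
      congr 1
      ext y
      rw [S.isRegularOfDegree_graph i hi x y]
    rw [SimpleGraph.lapMatrix, h, S.adjMatrix_graph i hi]
    exact Submodule.sub_mem _ (Submodule.smul_mem _ _ S.one_mem_boseMesner)
      (S.relMatrix_mem_boseMesner i)

end AssociationScheme

/-! ### Green's functions and effective resistances -/

namespace SimpleGraph

variable {X : Type*} [Fintype X] [DecidableEq X] (G : SimpleGraph X) [DecidableRel G.Adj]

theorem sum_lapMatrix_mulVec (v : X → ℝ) : ∑ u, (G.lapMatrix ℝ *ᵥ v) u = 0 := by
  have h : (fun _ : X => (1 : ℝ)) ⬝ᵥ G.lapMatrix ℝ *ᵥ v = 0 := by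
    rw [dotProduct_mulVec, ← mulVec_transpose, G.isSymm_lapMatrix (R := ℝ),
      G.lapMatrix_mulVec_const_eq_zero, zero_dotProduct]
  simpa [dotProduct] using h

variable {G}

theorem sum_eq_of_lapMatrix_add_allOnes_mulVec {v w : X → ℝ}
    (h : (G.lapMatrix ℝ + Matrix.of fun _ _ => 1) *ᵥ v = w) :
    (Fintype.card X : ℝ) * ∑ u, v u = ∑ u, w u := by
  rw [← h, add_mulVec]
  simp only [Pi.add_apply, Finset.sum_add_distrib, G.sum_lapMatrix_mulVec v]
  simp [mulVec, dotProduct]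

theorem Connected.eq_zero_of_lapMatrix_add_allOnes_mulVec (hG : G.Connected) {v : X → ℝ}
    (h : (G.lapMatrix ℝ + Matrix.of fun _ _ => 1) *ᵥ v = 0) : v = 0 := by
  have := hG.nonempty
  have hs : ∑ u, v u = 0 := by
    have := sum_eq_of_lapMatrix_add_allOnes_mulVec h
    simpa using this
  have hL : G.lapMatrix ℝ *ᵥ v = 0 := by
    have hJ : (Matrix.of fun _ _ : X => (1 : ℝ)) *ᵥ v = 0 := by
      ext u; simp [mulVec, dotProduct, hs]
    rwa [add_mulVec, hJ, add_zero] at h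
  ext x
  have hc := fun y => (G.lapMatrix_mulVec_eq_zero_iff_forall_reachable.1 hL) y x
    (hG.preconnected y x)
  rw [Finset.sum_congr rfl fun y _ => hc y] at hs
  simpa using hs

end SimpleGraph

/-- The Bose–Mesner algebra is finite-dimensional and contains `L + J`, so it contains the inverse
of `L + J` as well. -/
theorem AssociationScheme.exists_green_mem_boseMesner {X : Type*} [Fintype X] [DecidableEq X]
    {n : ℕ} (S : AssociationScheme X n) (i : Fin (n + 1)) (hi : i ≠ 0)
    [DecidableRel (S.graph i hi).Adj] (hG : (S.graph i hi).Connected) :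
    ∃ N ∈ S.boseMesner, ((S.graph i hi).lapMatrix ℝ + Matrix.of fun _ _ => 1) * N = 1 := by
  set B := (S.graph i hi).lapMatrix ℝ + Matrix.of fun _ _ => 1 with hB
  have hBmem : B ∈ S.boseMesner :=
    Submodule.add_mem _ (S.lapMatrix_graph_mem_boseMesner i hi) S.allOnes_mem_boseMesner
  let T : S.boseMesner →ₗ[ℝ] S.boseMesner :=
    (LinearMap.mulLeft ℝ B).restrict fun _ hM => S.mul_mem_boseMesner hBmem hM
  have hinj : Function.Injective T := by
    rw [← LinearMap.ker_eq_bot, LinearMap.ker_eq_bot']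
    rintro ⟨M, hM⟩ h
    have h0 : B * M = 0 := congrArg Subtype.val h
    refine Subtype.ext ?_
    ext x y
    have hcol : B *ᵥ (fun u => M u y) = 0 := by
      ext u
      exact congrFun (congrFun h0 u) y
    exact congrFun (hG.eq_zero_of_lapMatrix_add_allOnes_mulVec hcol) x
  obtain ⟨N, hN⟩ := LinearMap.injective_iff_surjective.1 hinj ⟨1, S.one_mem_boseMesner⟩
  exact ⟨N, N.2, congrArg Subtype.val hN⟩

namespace SimpleGraph

variable {X : Type*} [Fintype X] [DecidableEq X] (G : SimpleGraph X) [DecidableRel G.Adj]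

/-- The Dirichlet form `(f, g) ↦ fᵀ L g` of a graph, `L` being its Laplacian. -/
noncomputable def dirichletForm : (X → ℝ) →ₗ[ℝ] (X → ℝ) →ₗ[ℝ] ℝ :=
  toLinearMap₂' ℝ (G.lapMatrix ℝ)

theorem dirichletForm_eq_sum (f g : X → ℝ) :
    G.dirichletForm f g = ∑ u, f u * (G.lapMatrix ℝ *ᵥ g) u := by
  rw [dirichletForm, toLinearMap₂'_apply', dotProduct]

theorem dirichletForm_comm (f g : X → ℝ) : G.dirichletForm f g = G.dirichletForm g f := by
  rw [dirichletForm, toLinearMap₂'_apply', toLinearMap₂'_apply', dotProduct_mulVec,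
    ← mulVec_transpose, G.isSymm_lapMatrix (R := ℝ), dotProduct_comm]

theorem dirichletForm_self_nonneg (f : X → ℝ) : 0 ≤ G.dirichletForm f f := by
  rw [dirichletForm, lapMatrix_toLinearMap₂']
  positivity

variable {G}

/-- If all edges have the same effective resistance `2 (|X| - 1) / (|X| k)`, the quotient of the
number `|X| - 1` of edges of a spanning tree by the number of edges, then the potential difference
along an edge is bounded by the Dirichlet energy. -/
theorem IsRegularOfDegree.sq_sub_lt_of_green {k : ℕ} (hreg : G.IsRegularOfDegree k)
    {N : Matrix X X ℝ} (hN : (G.lapMatrix ℝ + Matrix.of fun _ _ => 1) * N = 1)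
    {a b : ℝ} (ha : ∀ x, N x x = a) (hb : ∀ x y, G.Adj x y → N x y = b)
    {x y : X} (hxy : G.Adj x y) (φ : X → ℝ) (hφ : φ x ≠ φ y) :
    k * (φ x - φ y) ^ 2 < 2 * G.dirichletForm φ φ := by
  have hcard : (0 : ℝ) < Fintype.card X := by exact_mod_cast Fintype.card_pos_iff.2 ⟨x⟩
  have hkpos : (0 : ℝ) < k := by
    rw [← hreg x]
    exact_mod_cast (G.degree_pos_iff_exists_adj x).2 ⟨y, hxy⟩
  -- the columns of `N` are Green's functions: `L N = 1 - J / |X|`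
  have hcol : ∀ z u, (G.lapMatrix ℝ *ᵥ fun w => N w z) u =
      (1 : Matrix X X ℝ) u z - 1 / Fintype.card X := by
    intro z u
    have h1 : (G.lapMatrix ℝ + Matrix.of fun _ _ => 1) *ᵥ (fun w => N w z) =
        fun w => (1 : Matrix X X ℝ) w z := by
      ext w
      exact congrFun (congrFun hN w) z
    have h2 := sum_eq_of_lapMatrix_add_allOnes_mulVec h1
    have h3 : ∑ w, (1 : Matrix X X ℝ) w z = 1 := by simp [one_apply]
    have h4 : ∑ w, N w z = 1 / Fintype.card X := by
      rw [h3] at h2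
      field_simp
      linarith
    have h5 := congrFun h1 u
    rw [add_mulVec, Pi.add_apply] at h5
    have h6 : ((Matrix.of fun _ _ : X => (1 : ℝ)) *ᵥ fun w => N w z) u = 1 / Fintype.card X := by
      simp [mulVec, dotProduct, h4]
    linarith
  have hab : k * (a - b) = 1 - 1 / Fintype.card X := by
    have h := hcol x x
    rw [lapMatrix_mulVec_apply, hreg x, one_apply_eq, ha,
      Finset.sum_congr rfl fun u hu => hb u x ((G.mem_neighborFinset x u).1 hu).symm,
      Finset.sum_const, G.card_neighborFinset_eq_degree, hreg x, nsmul_eq_mul] at h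
    linarith
  -- `g` is the potential of the unit current from `x` to `y`
  set g : X → ℝ := (fun w => N w x) - fun w => N w y with hg
  have hLg : ∀ ψ : X → ℝ, G.dirichletForm ψ g = ψ x - ψ y := by
    intro ψ
    rw [dirichletForm_eq_sum, hg, mulVec_sub]
    simp only [Pi.sub_apply, hcol, sub_sub_sub_cancel_right, mul_sub, Finset.sum_sub_distrib]
    simp [one_apply]
  have hgg : G.dirichletForm g g = 2 * (a - b) := by
    rw [hLg]
    simp only [hg, Pi.sub_apply, ha, hb x y hxy, hb y x hxy.symm]
    ring
  set D := φ x - φ y with hD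
  have hD0 : 0 < D ^ 2 := by
    have : D ≠ 0 := sub_ne_zero.2 hφ
    positivity
  have hfull : ∀ s : ℝ, 0 ≤ G.dirichletForm φ φ - 2 * s * D + s ^ 2 * (2 * (a - b)) := by
    intro s
    have h := G.dirichletForm_self_nonneg (φ - s • g)
    simp only [map_sub, map_smul, LinearMap.sub_apply, LinearMap.smul_apply, smul_eq_mul,
      G.dirichletForm_comm g φ, hgg, hLg φ] at h
    rw [← hD] at h
    linarith
  have hs := hfull (k * D / 2)
  have h7 : (k * D / 2) ^ 2 * (2 * (a - b)) = k * D ^ 2 / 2 * (1 - 1 / Fintype.card X) := by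
    rw [← hab]; ring
  have h8 : 0 < k * D ^ 2 / 2 * (1 / Fintype.card X : ℝ) := by positivity
  rw [h7] at hs
  linarith

end SimpleGraph

/-! ### Cuts -/

namespace SimpleGraph

variable {X : Type*} [Fintype X] [DecidableEq X] (G : SimpleGraph X) [DecidableRel G.Adj]

/-- The number of neighbours of `v` outside `S`. -/
def outDegree (S : Finset X) (v : X) : ℕ := #(G.neighborFinset v \ S)

/-- The number of edges between `S` and its complement. -/
def cutSize (S : Finset X) : ℕ := ∑ v ∈ S, G.outDegree S v

variable {G} {S : Finset X} {k : ℕ}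

theorem outDegree_pos {v w : X} (h : G.Adj v w) (hw : w ∉ S) : 0 < G.outDegree S v :=
  Finset.card_pos.2 ⟨w, by simp [h, hw]⟩

theorem lapMatrix_mulVec_indicator_of_mem {v : X} (hv : v ∈ S) :
    (G.lapMatrix ℝ *ᵥ fun u => if u ∈ S then 1 else 0) v = G.outDegree S v := by
  have h := Finset.card_sdiff_add_card_inter (G.neighborFinset v) S
  rw [card_neighborFinset_eq_degree] at h
  rw [lapMatrix_mulVec_apply, outDegree, ← h, if_pos hv, Finset.sum_ite_mem, Finset.sum_const]
  push_cast
  ring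

theorem lapMatrix_mulVec_indicator_of_notMem {v : X} (hv : v ∉ S) :
    (G.lapMatrix ℝ *ᵥ fun u => if u ∈ S then 1 else 0) v = -G.outDegree Sᶜ v := by
  rw [lapMatrix_mulVec_apply, outDegree, if_neg hv, Finset.sum_ite_mem]
  simp

theorem dirichletForm_single (x : X) (g : X → ℝ) :
    G.dirichletForm (Pi.single x 1) g = (G.lapMatrix ℝ *ᵥ g) x := by
  rw [dirichletForm, toLinearMap₂'_apply', single_one_dotProduct]

theorem IsRegularOfDegree.lapMatrix_mulVec_single_self (hreg : G.IsRegularOfDegree k) (x : X) :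
    (G.lapMatrix ℝ *ᵥ Pi.single x 1) x = k := by
  rw [lapMatrix_mulVec_apply, hreg x]
  simp [Pi.single_apply]

theorem lapMatrix_mulVec_single_of_ne {x y : X} (h : x ≠ y) :
    (G.lapMatrix ℝ *ᵥ Pi.single y 1) x = if G.Adj x y then -1 else 0 := by
  rw [lapMatrix_mulVec_apply]
  simp only [Pi.single_apply, Finset.sum_ite_eq', mem_neighborFinset, if_neg h]
  split_ifs <;> simp

theorem dirichletForm_indicator_left (g : X → ℝ) :
    G.dirichletForm (fun u => if u ∈ S then 1 else 0) g = ∑ u ∈ S, (G.lapMatrix ℝ *ᵥ g) u := by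
  rw [dirichletForm_eq_sum]
  simp

theorem dirichletForm_indicator_self (S : Finset X) :
    G.dirichletForm (fun u => if u ∈ S then 1 else 0) (fun u => if u ∈ S then 1 else 0) =
      G.cutSize S := by
  rw [dirichletForm_indicator_left, cutSize, Nat.cast_sum]
  exact Finset.sum_congr rfl fun v hv => lapMatrix_mulVec_indicator_of_mem hv

theorem cutSize_compl (S : Finset X) : G.cutSize Sᶜ = G.cutSize S := by
  have h := dirichletForm_indicator_left (G := G) (S := S) (fun u => if u ∈ S then 1 else 0)
  have h0 := G.sum_lapMatrix_mulVec (fun u => if u ∈ S then 1 else 0)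
  rw [← Finset.sum_add_sum_compl S, ← h, dirichletForm_indicator_self,
    Finset.sum_congr rfl fun v hv => lapMatrix_mulVec_indicator_of_notMem (mem_compl.1 hv),
    Finset.sum_neg_distrib] at h0
  rw [← Nat.cast_inj (R := ℝ), cutSize, Nat.cast_sum]
  linarith

theorem IsRegularOfDegree.cutSize_singleton (hreg : G.IsRegularOfDegree k) (x : X) :
    G.cutSize {x} = k := by
  rw [cutSize, Finset.sum_singleton, outDegree, Finset.sdiff_singleton_eq_erase,
    Finset.erase_eq_of_notMem (by simp), card_neighborFinset_eq_degree, hreg x]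

theorem IsRegularOfDegree.cutSize_erase (hreg : G.IsRegularOfDegree k) {x : X} (hx : x ∈ S) :
    G.cutSize (S.erase x) + 2 * G.outDegree S x = G.cutSize S + k := by
  have hf : (fun u => if u ∈ S.erase x then (1 : ℝ) else 0) =
      (fun u => if u ∈ S then 1 else 0) - Pi.single x 1 := by
    ext u
    by_cases hu : u = x
    · simp [hu, hx]
    · simp [hu]
  have h := dirichletForm_indicator_self (G := G) (S.erase x)
  rw [hf] at h
  simp only [map_sub, LinearMap.sub_apply] at h
  rw [dirichletForm_indicator_self, G.dirichletForm_comm _ (Pi.single x 1), dirichletForm_single,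
    dirichletForm_single, lapMatrix_mulVec_indicator_of_mem hx,
    hreg.lapMatrix_mulVec_single_self] at h
  rw [← Nat.cast_inj (R := ℝ)]
  push_cast
  linarith

/-- In a minimum cut of size less than the degree, moving a vertex to the other side does not
decrease the cut, so at most half of the edges at each vertex are cut. -/
theorem IsRegularOfDegree.two_mul_outDegree_le (hreg : G.IsRegularOfDegree k)
    (hmin : ∀ T : Finset X, T.Nonempty → T ≠ univ → G.cutSize S ≤ G.cutSize T)
    (hS : S ≠ univ) (hlt : G.cutSize S < k) {x : X} (hx : x ∈ S) :
    2 * G.outDegree S x ≤ k := by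
  have hne : (S.erase x).Nonempty := by
    rw [Finset.nonempty_iff_ne_empty]
    intro h
    rw [Finset.erase_eq_empty_iff] at h
    rcases h with rfl | rfl
    · simp at hx
    · rw [hreg.cutSize_singleton] at hlt
      exact lt_irrefl _ hlt
  have h1 := hmin _ hne fun h => hS (univ_subset_iff.1 (h ▸ erase_subset x S))
  have h2 := hreg.cutSize_erase hx
  omega

/-- If the degree is even, then so is every cut, since `k |S| = 2 e(S) + |∂S|`. -/
theorem IsRegularOfDegree.even_cutSize (hreg : G.IsRegularOfDegree k) (hk : Even k) :
    Even (G.cutSize S) := by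
  have h : ∑ v ∈ S, #(G.neighborFinset v ∩ S) + G.cutSize S = #S * k := by
    rw [cutSize, ← Finset.sum_add_distrib, ← smul_eq_mul, ← Finset.sum_const]
    refine Finset.sum_congr rfl fun v _ => ?_
    rw [outDegree, Finset.card_inter_add_card_sdiff, card_neighborFinset_eq_degree, hreg v]
  have h2 : Even (∑ v ∈ S, #(G.neighborFinset v ∩ S)) := by
    rw [← ZMod.natCast_eq_zero_iff_even]
    have h3 : ∀ v, #(G.neighborFinset v ∩ S) = ∑ w ∈ S, if G.Adj v w then 1 else 0 := by
      intro v
      rw [Finset.sum_boole, Nat.cast_id]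
      congr 1
      ext w
      simp [and_comm]
    simp only [h3, Nat.cast_sum, ← Finset.sum_product', Nat.cast_ite, Nat.cast_one, Nat.cast_zero]
    refine Finset.sum_involution (fun p _ => p.swap) ?_ ?_ ?_ ?_
    · rintro ⟨u, v⟩ _
      simp only [Prod.swap, G.adj_comm v u]
      exact CharTwo.add_self_eq_zero _
    · rintro ⟨u, v⟩ _ hne heq
      obtain rfl : v = u := congrArg Prod.fst heq
      simp at hne
    · rintro ⟨u, v⟩ hp
      simpa [and_comm] using hp
    · simp
  have h4 : Even (∑ v ∈ S, #(G.neighborFinset v ∩ S) + G.cutSize S) := h ▸ hk.mul_left _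
  exact (Nat.even_add.1 h4).1 h2

end SimpleGraph

/-! ### Small cuts and the resistance bound -/

namespace SimpleGraph

variable {X : Type*} [Fintype X] [DecidableEq X] (G : SimpleGraph X) [DecidableRel G.Adj]

/-- Every edge has effective resistance less than `2 / k`, in variational form: by Dirichlet's
principle, that resistance is the supremum of `(φ x - φ y) ^ 2 / E(φ)`, `E` being the energy. -/
def ResistanceBound (k : ℕ) : Prop :=
  ∀ ⦃x y : X⦄, G.Adj x y → ∀ φ : X → ℝ, φ x ≠ φ y →
    k * (φ x - φ y) ^ 2 < 2 * G.dirichletForm φ φ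

variable {G} {S : Finset X} {k : ℕ}

/-- An edge `xy` of a small cut is incident with many edges of the cut: the test potential is
`2 · 1_S + v (δ_x - δ_y)` with `v = k - outDegree S x - outDegree Sᶜ y`. -/
theorem ResistanceBound.sq_add_lt (hR : G.ResistanceBound k) (hreg : G.IsRegularOfDegree k)
    {x y : X} (hx : x ∈ S) (hy : y ∉ S) (hxy : G.Adj x y) {v : ℕ}
    (hv : G.outDegree S x + G.outDegree Sᶜ y + v = k) :
    v ^ 2 + k < 2 * G.cutSize S := by
  set f : X → ℝ := fun u => if u ∈ S then 1 else 0 with hf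
  have hne : x ≠ y := hxy.ne
  set φ : X → ℝ := (2 : ℝ) • f + (v : ℝ) • (Pi.single x 1 - Pi.single y 1) with hφ
  have hdiff : φ x - φ y = 2 + 2 * v := by
    simp [hφ, hf, hx, hy, hne, hne.symm]
    ring
  have hE : G.dirichletForm φ φ = 4 * G.cutSize S +
      4 * v * (G.outDegree S x + G.outDegree Sᶜ y) + v ^ 2 * (2 * k + 2) := by
    rw [hφ]
    simp only [map_add, map_sub, map_smul, LinearMap.add_apply, LinearMap.sub_apply,
      LinearMap.smul_apply, smul_eq_mul, G.dirichletForm_comm f (Pi.single _ _)]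
    simp only [dirichletForm_single, hf, dirichletForm_indicator_self,
      lapMatrix_mulVec_indicator_of_mem hx, lapMatrix_mulVec_indicator_of_notMem hy,
      hreg.lapMatrix_mulVec_single_self, lapMatrix_mulVec_single_of_ne hne,
      lapMatrix_mulVec_single_of_ne hne.symm, hxy, hxy.symm, if_true]
    ring
  have hpos : φ x ≠ φ y := by
    rw [← sub_ne_zero, hdiff]
    positivity
  have h := hR hxy φ hpos
  have hv' : (G.outDegree S x + G.outDegree Sᶜ y : ℝ) = k - v := by
    rw [← hv]; push_cast; ring
  rw [hdiff, hE, hv'] at h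
  have h' : (v : ℝ) ^ 2 + k < 2 * G.cutSize S := by nlinarith
  exact_mod_cast h'

/-- The edges of a cut of size `2a` cannot form a complete bipartite graph between two vertices
`x`, `x'` of `S` and `a` vertices outside `S` when the degree is `2a + 1` and `a` is `2` or `3`.
The test potential is `(3/2) 1_S + (δ_x - δ_x') / 2 - (δ_y - 1_N / a)`, where `N` is the common
neighbourhood of `x` and `x'` outside `S`. -/
theorem ResistanceBound.false_of_biclique (hR : G.ResistanceBound k)
    (hreg : G.IsRegularOfDegree k) {x x' y : X} (hx : x ∈ S) (hx' : x' ∈ S) (hxx' : x ≠ x')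
    {N : Finset X} (hN : G.neighborFinset x \ S = N) (hN' : G.neighborFinset x' \ S = N)
    (hy : y ∈ N) (hout : ∀ z ∈ N, G.outDegree Sᶜ z = 2) (hcut : G.cutSize S = 2 * #N)
    (ha : #N = 2 ∨ #N = 3) (hk : k = 2 * #N + 1) : False := by
  have hxN : ∀ z ∈ N, G.Adj x z ∧ z ∉ S := fun z hz => by simpa [← hN] using hz
  have hxN' : ∀ z ∈ N, G.Adj x' z ∧ z ∉ S := fun z hz => by simpa [← hN'] using hz
  obtain ⟨hxy, hyS⟩ := hxN y hy
  have hxy' := (hxN' y hy).1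
  have hxnN : x ∉ N := fun h => (hxN x h).2 hx
  have hxnN' : x' ∉ N := fun h => (hxN' x' h).2 hx'
  set f : X → ℝ := fun u => if u ∈ S then 1 else 0 with hf
  set g : X → ℝ := fun u => if u ∈ N then 1 else 0 with hg
  have hL : ∀ z, z ∉ N → (∀ w ∈ N, G.Adj z w) → (G.lapMatrix ℝ *ᵥ g) z = -(#N : ℝ) := by
    intro z hz hadj
    rw [hg, lapMatrix_mulVec_indicator_of_notMem hz, outDegree, sdiff_compl,
      Finset.inf_eq_inter, Finset.inter_eq_right.2 fun w hw => by simp [hadj w hw]]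
  have hLx := hL x hxnN fun w hw => (hxN w hw).1
  have hLx' := hL x' hxnN' fun w hw => (hxN' w hw).1
  have hLy : (k - #N + 1 : ℝ) ≤ (G.lapMatrix ℝ *ᵥ g) y := by
    rw [hg, lapMatrix_mulVec_indicator_of_mem hy, outDegree]
    have h1 := Finset.card_sdiff_add_card_inter (G.neighborFinset y) N
    rw [card_neighborFinset_eq_degree, hreg y] at h1
    have h2 : #(G.neighborFinset y ∩ N) < #N :=
      Finset.card_lt_card ⟨Finset.inter_subset_right, fun h => by simpa using h hy⟩
    have h3 : k + 1 ≤ #(G.neighborFinset y \ N) + #N := by omega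
    have h4 : (k + 1 : ℝ) ≤ #(G.neighborFinset y \ N) + #N := by exact_mod_cast h3
    linarith
  have hgg : G.dirichletForm g g ≤ #N * k := by
    rw [hg, dirichletForm_indicator_self, cutSize]
    have h1 : ∑ v ∈ N, G.outDegree N v ≤ #N * k := by
      rw [← smul_eq_mul]
      refine Finset.sum_le_card_nsmul _ _ _ fun v _ => ?_
      rw [← hreg v, ← card_neighborFinset_eq_degree]
      exact Finset.card_le_card Finset.sdiff_subset
    exact_mod_cast h1
  have hgf : G.dirichletForm g f = -(#N * 2 : ℝ) := by
    rw [hg, dirichletForm_indicator_left, Finset.sum_congr rfl fun z hz => by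
      rw [hf, lapMatrix_mulVec_indicator_of_notMem (hxN z hz).2, hout z hz]]
    simp
  have hxx1 : (G.lapMatrix ℝ *ᵥ Pi.single x' 1) x = (G.lapMatrix ℝ *ᵥ Pi.single x 1) x' := by
    rw [lapMatrix_mulVec_single_of_ne hxx', lapMatrix_mulVec_single_of_ne hxx'.symm]
    simp only [G.adj_comm x x']
  have hxx2 : -1 ≤ (G.lapMatrix ℝ *ᵥ Pi.single x 1) x' := by
    rw [lapMatrix_mulVec_single_of_ne hxx'.symm]
    split_ifs <;> norm_num
  set φ : X → ℝ := (3 / 2 : ℝ) • f + (1 / 2 : ℝ) • (Pi.single x 1 - Pi.single x' 1)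
    - (Pi.single y 1 - (1 / #N : ℝ) • g) with hφ
  have hdiff : φ x - φ y = 3 - 1 / #N := by
    simp [hφ, hf, hg, hx, hyS, hy, hxnN, hxx', hxy.ne, hxy.ne', hxy'.ne']
    ring
  have hNpos : (0 : ℝ) < #N := by exact_mod_cast Finset.card_pos.2 ⟨y, hy⟩
  have hE : G.dirichletForm φ φ = 9 / 4 * (2 * #N) + 3 / 2 * k
      + G.dirichletForm g g / #N ^ 2 - 1 / 2 * (G.lapMatrix ℝ *ᵥ Pi.single x 1) x'
      - 2 / #N * (G.lapMatrix ℝ *ᵥ g) y := by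
    rw [hφ]
    simp only [map_add, map_sub, map_smul, LinearMap.add_apply, LinearMap.sub_apply,
      LinearMap.smul_apply, smul_eq_mul, G.dirichletForm_comm f (Pi.single _ _),
      G.dirichletForm_comm g (Pi.single _ _), G.dirichletForm_comm f g, hgf]
    simp only [dirichletForm_single, hf, dirichletForm_indicator_self,
      lapMatrix_mulVec_indicator_of_mem hx, lapMatrix_mulVec_indicator_of_mem hx',
      lapMatrix_mulVec_indicator_of_notMem hyS,
      hreg.lapMatrix_mulVec_single_self, hxx1, hLx, hLx', hout y hy, hcut,
      lapMatrix_mulVec_single_of_ne hxy.ne, lapMatrix_mulVec_single_of_ne hxy.ne',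
      lapMatrix_mulVec_single_of_ne hxy'.ne, lapMatrix_mulVec_single_of_ne hxy'.ne',
      hxy, hxy.symm, hxy', hxy'.symm, if_true]
    rw [outDegree, outDegree, hN, hN']
    push_cast
    field_simp
    ring
  have hpos : φ x ≠ φ y := by
    rw [← sub_ne_zero, hdiff]
    rcases ha with ha | ha <;> rw [ha] <;> norm_num
  have h := hR hxy φ hpos
  rw [hdiff, hE] at h
  generalize (G.lapMatrix ℝ *ᵥ Pi.single x 1) x' = m at h hxx2
  rcases ha with ha | ha <;> simp only [ha] at hk <;> subst hk <;>
    simp only [ha] at h hgg hLy <;> norm_num at h hgg hLy <;> linarith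

/-- The numerical part of the argument. In a cut of size `c < k`, let `xy` be an edge of the cut
with `a` and `b` cut edges at its ends, `a + b + v = k`. -/
theorem cut_arith {k a b c v : ℕ} (hv : a + b + v = k) (ha : 2 * a ≤ k) (hb : 2 * b ≤ k)
    (hc : c < k) (hab : a * b ≤ c) (hvc : v ^ 2 + k < 2 * c) (heven : Even k → Even c) :
    c = a * b ∧ k = 2 * max a b + 1 ∧ (a = 2 ∧ b = 2 ∨ a = 3 ∧ b = 2 ∨ a = 2 ∧ b = 3) := by
  have hkv : k < 2 * v + 4 := by
    by_contra! h
    have h1 : (k : ℤ) * (k - 2 * v) ≤ 4 * (a * b) := by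
      have e : (k : ℤ) = a + b + v := by exact_mod_cast hv.symm
      have ha' : 2 * (a : ℤ) ≤ k := by exact_mod_cast ha
      have hb' : 2 * (b : ℤ) ≤ k := by exact_mod_cast hb
      nlinarith [mul_nonneg (sub_nonneg.2 ha') (sub_nonneg.2 hb')]
    zify at *
    nlinarith
  have hv3 : v < 3 := by nlinarith
  have hk : k < 8 := by omega
  have ha4 : a < 4 := by omega
  have hb4 : b < 4 := by omega
  rw [Nat.even_iff, Nat.even_iff] at heven
  interval_cases v <;> interval_cases a <;> interval_cases b <;> omega

/-- If `b = 2` and the bound `a b ≤ |∂S|` at an edge `xy` of the cut with minimum `a + b` is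
attained, then all edges of the cut lie between `x`, another vertex `x'`, and their common
neighbours outside `S`. -/
theorem exists_biclique {x y : X} (hx : x ∈ S) (hy : y ∉ S) (hxy : G.Adj x y)
    (hmin : ∀ u ∈ S, ∀ w ∉ S, G.Adj u w →
      G.outDegree S x + G.outDegree Sᶜ y ≤ G.outDegree S u + G.outDegree Sᶜ w)
    (hcut : G.cutSize S = G.outDegree S x * 2) (hb : G.outDegree Sᶜ y = 2) :
    ∃ x' ∈ S, x ≠ x' ∧ G.neighborFinset x' \ S = G.neighborFinset x \ S ∧
      ∀ z ∈ G.neighborFinset x \ S, G.outDegree Sᶜ z = 2 := by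
  set N := G.neighborFinset x \ S with hN
  have hNS : N ⊆ Sᶜ := fun z hz => by simp_all
  have hyN : y ∈ N := by simp [hN, hxy, hy]
  have hge : ∀ z ∈ N, 2 ≤ G.outDegree Sᶜ z := fun z hz => by
    have hz' : G.Adj x z ∧ z ∉ S := by simpa [hN] using hz
    have := hmin x hx z hz'.2 hz'.1
    omega
  have hsum : ∑ z ∈ N, G.outDegree Sᶜ z + ∑ z ∈ Sᶜ \ N, G.outDegree Sᶜ z = ∑ z ∈ N, 2 := by
    rw [add_comm, Finset.sum_sdiff hNS, ← cutSize, cutSize_compl, hcut]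
    simp [outDegree, hN]
  have hle : ∑ z ∈ N, 2 ≤ ∑ z ∈ N, G.outDegree Sᶜ z := Finset.sum_le_sum hge
  have heq : ∀ z ∈ N, 2 = G.outDegree Sᶜ z :=
    (Finset.sum_eq_sum_iff_of_le hge).1 (by omega)
  have hzero : ∀ z ∈ Sᶜ \ N, G.outDegree Sᶜ z = 0 := Finset.sum_eq_zero_iff.1 (by omega)
  obtain ⟨x', hx', hne⟩ := Finset.exists_mem_ne
    (show 1 < #(G.neighborFinset y \ Sᶜ) by rw [← outDegree, hb]; norm_num) x
  rw [mem_sdiff, mem_compl, not_not, mem_neighborFinset] at hx'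
  refine ⟨x', hx'.2, hne.symm, ?_, fun z hz => (heq z hz).symm⟩
  refine Finset.eq_of_subset_of_card_le (fun z hz => ?_) ?_
  · rw [mem_sdiff, mem_neighborFinset] at hz
    by_contra hzN
    have h0 := hzero z (by simp [hz.2, hzN])
    have := outDegree_pos (S := Sᶜ) hz.1.symm (by simpa using hx'.2)
    omega
  · have := hmin x' hx'.2 y hy hx'.1.symm
    simpa [outDegree, hN] using this

omit [DecidableRel G.Adj] in
theorem Connected.exists_adj_of_cut (hG : G.Connected) (hS : S.Nonempty) (hS' : S ≠ univ) :
    ∃ x ∈ S, ∃ y ∉ S, G.Adj x y := by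
  obtain ⟨u, hu⟩ := hS
  obtain ⟨w, hw⟩ : ∃ w, w ∉ S := by
    by_contra! h
    exact hS' (Finset.eq_univ_iff_forall.2 h)
  obtain ⟨p⟩ := hG.preconnected u w
  obtain ⟨d, -, h1, h2⟩ := p.exists_boundary_dart (S : Set X) (by simpa) (by simpa)
  exact ⟨d.fst, by simpa using h1, d.snd, by simpa using h2, d.adj⟩

theorem ResistanceBound.le_cutSize (hR : G.ResistanceBound k) (hreg : G.IsRegularOfDegree k)
    (hG : G.Connected) (hS : S.Nonempty) (hS' : S ≠ univ) : k ≤ G.cutSize S := by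
  -- it suffices to treat a minimum cut
  obtain ⟨T, hT, hmin⟩ := Finset.exists_min_image
    {T : Finset X | T.Nonempty ∧ T ≠ univ} G.cutSize ⟨S, by simp [hS, hS']⟩
  simp only [mem_filter, mem_univ, true_and, and_imp] at hT hmin
  obtain ⟨hT, hT'⟩ := hT
  refine le_trans ?_ (hmin S hS hS')
  by_contra! hlt
  have hminc : ∀ U : Finset X, U.Nonempty → U ≠ univ → G.cutSize Tᶜ ≤ G.cutSize U := by
    rwa [cutSize_compl]
  have hTc : Tᶜ ≠ univ := by simpa using hT.ne_empty
  have hltc : G.cutSize Tᶜ < k := by rwa [cutSize_compl]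
  -- an edge of the cut that is incident with as few edges of the cut as possible
  obtain ⟨⟨x, y⟩, hp, hxymin⟩ := Finset.exists_min_image
    {p : X × X | p.1 ∈ T ∧ p.2 ∉ T ∧ G.Adj p.1 p.2}
    (fun p => G.outDegree T p.1 + G.outDegree Tᶜ p.2) (by
      obtain ⟨x, hx, y, hy, h⟩ := hG.exists_adj_of_cut hT hT'
      exact ⟨(x, y), by simp [hx, hy, h]⟩)
  simp only [mem_filter, mem_univ, true_and, and_imp, Prod.forall] at hp hxymin
  obtain ⟨hx, hy, hxy⟩ := hp
  have ha := hreg.two_mul_outDegree_le hmin hT' hlt hx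
  have hb := hreg.two_mul_outDegree_le hminc hTc hltc (mem_compl.2 hy)
  obtain ⟨v, hv⟩ : ∃ v, G.outDegree T x + G.outDegree Tᶜ y + v = k :=
    ⟨k - (G.outDegree T x + G.outDegree Tᶜ y), by omega⟩
  have hab : G.outDegree T x * G.outDegree Tᶜ y ≤ G.cutSize T := by
    rw [← cutSize_compl, cutSize]
    calc G.outDegree T x * G.outDegree Tᶜ y
        ≤ ∑ z ∈ G.neighborFinset x \ T, G.outDegree Tᶜ z := by
          rw [outDegree, ← smul_eq_mul]
          refine Finset.card_nsmul_le_sum _ _ _ fun z hz => ?_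
          rw [mem_sdiff, mem_neighborFinset] at hz
          have := hxymin x z hx hz.2 hz.1
          omega
      _ ≤ ∑ z ∈ Tᶜ, G.outDegree Tᶜ z :=
          Finset.sum_le_sum_of_subset fun z hz => by simp_all
  obtain ⟨hc, hk, hcase⟩ := cut_arith hv ha hb hlt hab (hR.sq_add_lt hreg hx hy hxy hv)
    fun h => hreg.even_cutSize h
  by_cases hb2 : G.outDegree Tᶜ y = 2
  · have ha2 : G.outDegree T x = 2 ∨ G.outDegree T x = 3 := by omega
    rw [hb2] at hc
    obtain ⟨x', hx', hne, hN', hout⟩ := exists_biclique hx hy hxy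
      (fun u hu w hw h => hxymin u w hu hw h) hc hb2
    exact hR.false_of_biclique hreg hx hx' hne (y := y) rfl hN' (by simp [hxy, hy]) hout
      (by rw [hc, outDegree, mul_comm]) ha2 (by rw [← outDegree]; omega)
  · -- the remaining case is the previous one with the two sides exchanged
    have ha2 : G.outDegree T x = 2 := by omega
    have hb3 : G.outDegree Tᶜ y = 3 := by omega
    have hyc : y ∈ Tᶜ := mem_compl.2 hy
    have hxc : x ∉ Tᶜ := by simpa using hx
    have hcc : G.cutSize Tᶜ = G.outDegree Tᶜ y * 2 := by rw [cutSize_compl, hc, ha2, mul_comm]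
    obtain ⟨y', hy', hne, hN', hout⟩ := exists_biclique hyc hxc hxy.symm
      (fun u hu w hw h => by
        have := hxymin w u (by simpa using hw) (by simpa using hu) h.symm
        rw [compl_compl]
        omega) hcc (by rwa [compl_compl])
    exact hR.false_of_biclique hreg hyc hy' hne (y := x) rfl hN' (by simp [hxy.symm, hx]) hout
      (by rw [hcc, outDegree, mul_comm]) (Or.inr (by rw [← outDegree, hb3]))
      (by rw [← outDegree]; omega)

end SimpleGraph

/-! ### Edge-connectivity -/

namespace SimpleGraph

variable {X : Type*} [Fintype X] [DecidableEq X] {G : SimpleGraph X} [DecidableRel G.Adj] {k : ℕ}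

/-- If every cut has at least `k` edges, then fewer than `k` edges do not disconnect the graph:
otherwise they would contain all edges leaving a connected component of the remaining graph. -/
theorem isEdgeConnected_of_le_cutSize
    (h : ∀ S : Finset X, S.Nonempty → S ≠ univ → k ≤ G.cutSize S) : G.IsEdgeConnected k := by
  classical
  intro u w s hs
  by_contra hnr
  set T : Finset X := {z | (G.deleteEdges s).Reachable u z} with hT
  have huT : u ∈ T := by simp [hT]
  have hwT : w ∉ T := by simpa [hT] using hnr
  have hk := h T ⟨u, huT⟩ fun h => hwT (h ▸ mem_univ w)
  set C : Finset (Sym2 X) :=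
    (T.sigma fun v => G.neighborFinset v \ T).image fun p => s(p.1, p.2) with hC
  have hcard : #C = G.cutSize T := by
    rw [hC, Finset.card_image_of_injOn, Finset.card_sigma]
    · rfl
    · rintro ⟨a, b⟩ hab ⟨c, d⟩ hcd heq
      simp only [coe_sigma, Set.mem_sigma_iff, mem_coe, mem_sdiff] at hab hcd
      rcases Sym2.eq_iff.1 heq with ⟨h1, h2⟩ | ⟨h1, h2⟩
      · simp only at h1 h2
        subst h1 h2
        rfl
      · simp only at h1 h2
        subst h1 h2
        exact absurd hab.1 hcd.2.2
  have hsub : (C : Set (Sym2 X)) ⊆ s := by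
    intro e he
    simp only [hC, coe_image, Set.mem_image, mem_coe, mem_sigma, mem_sdiff,
      mem_neighborFinset, Sigma.exists] at he
    obtain ⟨a, b, ⟨ha, hab, hb⟩, rfl⟩ := he
    by_contra hes
    have ha' : (G.deleteEdges s).Reachable u a := by simpa [hT] using ha
    have hadj : (G.deleteEdges s).Adj a b := deleteEdges_adj.2 ⟨hab, hes⟩
    exact hb (by simpa [hT] using ha'.trans hadj.reachable)
  have hle := Set.encard_le_encard hsub
  rw [Set.encard_coe_eq_coe_finsetCard, hcard] at hle
  have : (k : ℕ∞) ≤ G.cutSize T := by exact_mod_cast hk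
  exact absurd hs (not_lt.2 (this.trans hle))

end SimpleGraph

theorem AssociationScheme.resistanceBound_graph {X : Type*} [Fintype X] [DecidableEq X] {n : ℕ}
    (S : AssociationScheme X n) (i : Fin (n + 1)) (hi : i ≠ 0)
    [DecidableRel (S.graph i hi).Adj] (hG : (S.graph i hi).Connected) {k : ℕ}
    (hreg : (S.graph i hi).IsRegularOfDegree k) : (S.graph i hi).ResistanceBound k := by
  obtain ⟨N, hN, hLN⟩ := S.exists_green_mem_boseMesner i hi hG
  intro x y hxy φ hφ
  exact hreg.sq_sub_lt_of_green hLN (a := N x x) (b := N x y)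
    (fun z => S.apply_eq_of_mem_boseMesner hN (S.diag_mem z) (S.diag_mem x))
    (fun z w hzw => S.apply_eq_of_mem_boseMesner hN (j := i) hzw hxy) hxy φ hφ

end

theorem mainTheorem2 {X : Type*} [Fintype X] [DecidableEq X] (G : SimpleGraph X)
    [DecidableRel G.Adj] (hG : G.IsColourClass) (hconn : G.Connected) :
    ∃ k : ℕ, G.IsRegularOfDegree k ∧ G.edgeConnectivity = k := by
  obtain ⟨n, S, i, hi, rfl⟩ := hG
  -- `X` has at least two points because the relation `R i` is nonempty and irreflexive
  obtain ⟨⟨x, y⟩, hxy⟩ := S.nonempty i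
  have hadj : (S.graph i hi).Adj x y := hxy
  have : Nontrivial X := ⟨x, y, hadj.ne⟩
  have hreg := S.isRegularOfDegree_graph i hi x
  refine ⟨_, hreg, le_antisymm ?_ ?_⟩
  · exact SimpleGraph.IsEdgeConnected.le_degree
      (SimpleGraph.isGreatest_edgeConnectivity (S.graph i hi)).1
  · exact (SimpleGraph.isGreatest_edgeConnectivity (S.graph i hi)).2
      (SimpleGraph.isEdgeConnected_of_le_cutSize fun T hT hT' =>
        (S.resistanceBound_graph i hi hconn hreg).le_cutSize hreg hconn hT hT')
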